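/- Let $n,d\ge 1$ be integers, and write points of $\mathbb{R}^{n+d}=\mathbb{R}^n\times\mathbb{R}^d$ as $(z,x)$. For $A\subseteq\mathbb{R}^{n+d}$ put $$\mathcal{H}_d(A)=\sum_{z\in\mathbb{Z}^n}\operatorname{vol}_d\bigl(\{x\in\mathbb{R}^d:(z,x)\in A\}\bigr),$$ where $\operatorname{vol}_d$ is $d$-dimensional Lebesgue measure (the mixed-integer volume of $A$). Let $C\subset\mathbb{R}^{n+d}$ be a convex body, i.e. a compact convex set with nonempty interior, let $S=C\cap(\mathbb{Z}^n\times\mathbb{R}^d)$, and let $K=\{z\in\mathbb{R}^n:(z,x)\in C\text{ for some }x\in\mathbb{R}^d\}$ be the projection of $C$ onto $\mathbb{R}^n$. Assume that there are $z_0\in\mathbb{R}^n$ and a real number $k\ge\frac{3e}{2}(n+d)$ such that $z_0+k\,\mathbb{B}_\infty^n\subseteq K$, where $\mathbb{B}_\infty^n=\{u\in\mathbb{R}^n:|u_i|\le 1\text{ for all }i\}$. Then there exists a point $y^\star\in S$ such that every closed halfspace $H=\{y\in\mathbb{R}^{n+d}:a^{\mathsf T}y\ge c\}$ (with $a\in\mathbb{R}^{n+d}\setminus\{0\}$,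 $c\in\mathbb{R}$) containing $y^\star$ satisfies $$\mathcal{H}_d(S\cap H)\ \ge\ \Bigl(\frac1e-\frac{3(n+d)}{2k}\Bigr)\mathcal{H}_d(S).$$ -/

import Mathlib

open MeasureTheory
open scoped ENNReal

/-- The space `ℝ^{n+d} = ℝ^n × ℝ^d`, whose points are written `y = (z, x)`. -/
abbrev MixedSpace (n d : ℕ) : Type := (Fin n → ℝ) × (Fin d → ℝ)

/-- A convex body: a compact convex set with nonempty interior. -/
structure IsConvexBody {n d : ℕ} (C : Set (MixedSpace n d)) : Prop where
  isCompact : IsCompact C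
  convex : Convex ℝ C
  interior_nonempty : (interior C).Nonempty

/-- The real vector with the given integer coordinates. -/
def intVec {n : ℕ} (z : Fin n → ℤ) : Fin n → ℝ := fun i => (z i : ℝ)

/-- The mixed-integer lattice `ℤ^n × ℝ^d` inside `ℝ^n × ℝ^d`. -/
def mixedLattice (n d : ℕ) : Set (MixedSpace n d) :=
  {y | ∃ z : Fin n → ℤ, y.1 = intVec z}

/-- The fiber `A_z = {x ∈ ℝ^d : (z, x) ∈ A}`. -/
def fiber {n d : ℕ} (A : Set (MixedSpace n d)) (z : Fin n → ℝ) : Set (Fin d → ℝ) :=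
  {x | (z, x) ∈ A}

/-- The mixed-integer volume of `A`: the sum over `z ∈ ℤ^n` of the `d`-dimensional Lebesgue
measures of the fibers `A_z`. -/
noncomputable def mixedIntegerVolume {n d : ℕ} (A : Set (MixedSpace n d)) : ℝ≥0∞ :=
  ∑' z : Fin n → ℤ, volume (fiber A (intVec z))

/-- The projection of a subset of `ℝ^n × ℝ^d` onto `ℝ^n`. -/
def projZ {n d : ℕ} (A : Set (MixedSpace n d)) : Set (Fin n → ℝ) := Prod.fst '' A

/-- The closed unit ball of the `ℓ_∞` norm on `ℝ^n`. -/
def linftyBall (n : ℕ) : Set (Fin n → ℝ) := {u | ∀ i, |u i| ≤ 1}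

/-- A closed halfspace `{y : aᵀ y ≥ c}` of `ℝ^n × ℝ^d`, with `a ≠ 0`. -/
def IsClosedHalfspace {n d : ℕ} (H : Set (MixedSpace n d)) : Prop :=
  ∃ (a : MixedSpace n d) (c : ℝ), a ≠ 0 ∧
    H = {y | c ≤ dotProduct a.1 y.1 + dotProduct a.2 y.2}

/-!
The point `y` is the centroid `c` of `C` with its first `n` coordinates rounded to integers.

Every halfspace through `c` contains at least the fraction `1 / e` of the volume of `C`, by
Grünbaum's inequality (`volumeReal_le_exp_mul_capVolume`). Its proof rests on the log-concavity of
the volume of the caps `C ∩ {φ ≥ h}` as a function of `h`, an instance of the Prékopa–Leindler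
inequality, which is proved first on the line (`satisfiesPrekopaLeindler_real`) and then passed to
products by Fubini's theorem (`SatisfiesPrekopaLeindler.prod`).

Moving a halfspace by a small multiple `ε` of the width of `C` in its normal direction changes the
volume of the cap by about `(n + d) ε` times the volume of `C` at most
(`capVolume_sub_capVolume_mul_le`). Rounding moves the halfspace by at most `1 / (4 k)` of the
width, because the displacement can be chosen in `(C - C) / (4 k)`
(`exists_mem_mixedLattice_near`).

Volume and mixed-integer volume are compared by tiling `ℝ^n` with unit cubes around the lattice
points. The box in the projection of `C` makes it possible to pass between a lattice point and the
other points of its cube at the cost of shrinking `C` by the factor `1 - 1 / (2 k)`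
(`volume_le_mixedIntegerVolume`, `mixedIntegerVolume_le_volume`) and of moving the halfspace by
another `1 / (2 k)` of the width. With `t = (n + d) / (2 k)` the total is the fraction
`(1 - t)² (1 / e - 2 t) ≥ 1 / e - 3 t` (`mixedIntegerVolume_cap_ge`). The left side is positive, so
no closed halfspace containing `y` misses `C`, and `y` lies in `C`.
-/

/-! ### The Prékopa–Leindler inequality -/

/-- The Brunn–Minkowski inequality on the line: up to a single point, the translates `A + min B`
and `max A + B` are disjoint subsets of `A + B` when `A` and `B` are compact. -/
theorem volume_add_le_of_add_mem {A B Z : Set ℝ} (hA : MeasurableSet A) (hB : MeasurableSet B)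
    (hA' : A.Nonempty) (hB' : B.Nonempty) (hZ : ∀ a ∈ A, ∀ b ∈ B, a + b ∈ Z) :
    volume A + volume B ≤ volume Z := by
  have compact_case : ∀ K ⊆ A, ∀ L ⊆ B, IsCompact K → IsCompact L → K.Nonempty → L.Nonempty →
      volume K + volume L ≤ volume Z := by
    intro K hKA L hLB hK hL hK' hL'
    obtain ⟨p, hpK, hp⟩ := hK.exists_isGreatest hK'
    obtain ⟨q, hqL, hq⟩ := hL.exists_isLeast hL'
    have h1 : volume K = volume ((fun x => x + q) '' K) := by
      simp
    have h2 : volume L = volume ((fun x => p + x) '' L) := by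
      simp
    have hm : MeasurableSet ((fun x => p + x) '' L) :=
      (hL.image (by fun_prop)).measurableSet
    have hd : AEDisjoint volume ((fun x => x + q) '' K) ((fun x => p + x) '' L) := by
      refine measure_mono_null (t := {p + q}) ?_ (by simp)
      rintro _ ⟨⟨x, hx, rfl⟩, ⟨y, hy, hxy⟩⟩
      have := hp hx
      have := hq hy
      simp only at hxy
      simp only [Set.mem_singleton_iff]
      linarith
    rw [h1, h2, ← measure_union₀ hm.nullMeasurableSet hd]
    apply measure_mono
    rintro _ (⟨x, hx, rfl⟩ | ⟨y, hy, rfl⟩)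
    · exact hZ _ (hKA hx) _ (hLB hqL)
    · exact hZ _ (hKA hpK) _ (hLB hy)
  obtain ⟨a, ha⟩ := hA'
  obtain ⟨b, hb⟩ := hB'
  rw [hA.measure_eq_iSup_isCompact, hB.measure_eq_iSup_isCompact]
  simp_rw [iSup_and']
  refine ENNReal.biSup_add_biSup_le' ⟨∅, by simp⟩ ⟨∅, by simp⟩ ?_
  rintro K ⟨hKA, hK⟩ L ⟨hLB, hL⟩
  refine le_trans ?_ (compact_case (insert a K) (Set.insert_subset ha hKA) (insert b L)
    (Set.insert_subset hb hLB) (hK.insert a) (hL.insert b) (by simp) (by simp))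
  gcongr <;> simp

theorem ofReal_mul_volume_add_le {A B Z : Set ℝ} {s t : ℝ} (hs : 0 < s) (ht : 0 < t)
    (hA : MeasurableSet A) (hB : MeasurableSet B)
    (hA' : A.Nonempty) (hB' : B.Nonempty) (hZ : ∀ a ∈ A, ∀ b ∈ B, s * a + t * b ∈ Z) :
    ENNReal.ofReal s * volume A + ENNReal.ofReal t * volume B ≤ volume Z := by
  have h := volume_add_le_of_add_mem (hA.const_smul_of_ne_zero hs.ne')
    (hB.const_smul_of_ne_zero ht.ne') hA'.smul_set hB'.smul_set (Z := Z) (by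
      rintro _ ⟨a, ha, rfl⟩ _ ⟨b, hb, rfl⟩
      exact hZ a ha b hb)
  simpa [Measure.addHaar_smul, abs_of_pos hs, abs_of_pos ht] using h

theorem ENNReal.rpow_mul_rpow_le_add {s t : ℝ} (hs : 0 < s) (ht : 0 < t) (hst : s + t = 1)
    (a b : ℝ≥0∞) :
    a ^ s * b ^ t ≤ ENNReal.ofReal s * a + ENNReal.ofReal t * b := by
  rcases eq_or_ne a ∞ with rfl | ha
  · simp [ENNReal.mul_top, hs]
  rcases eq_or_ne b ∞ with rfl | hb
  · simp [ENNReal.mul_top, ht]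
  lift a to NNReal using ha
  lift b to NNReal using hb
  have := NNReal.geom_mean_le_arith_mean2_weighted s.toNNReal t.toNNReal a b (by
    rw [← Real.toNNReal_add hs.le ht.le, hst, Real.toNNReal_one])
  rw [Real.coe_toNNReal _ hs.le, Real.coe_toNNReal _ ht.le] at this
  rw [← ENNReal.coe_rpow_of_nonneg _ hs.le, ← ENNReal.coe_rpow_of_nonneg _ ht.le,
    ENNReal.ofReal, ENNReal.ofReal]
  exact_mod_cast this

/-- The additive form of the inequality on the line, for functions with supremum `1`: integrate
the Brunn–Minkowski inequality over the superlevel sets. -/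
theorem lintegral_add_le_of_iSup_eq_one {s t : ℝ} (hs : 0 < s) (ht : 0 < t) (hst : s + t = 1)
    {f g h : ℝ → ℝ≥0∞} (hf : Measurable f) (hg : Measurable g) (hh : Measurable h)
    (hfA : ⨆ x, f x = 1) (hgB : ⨆ x, g x = 1)
    (H : ∀ x y, f x ^ s * g y ^ t ≤ h (s * x + t * y)) :
    ENNReal.ofReal s * (∫⁻ x, f x) + ENNReal.ofReal t * (∫⁻ x, g x) ≤ ∫⁻ x, h x := by
  have layer : ∀ u : ℝ → ℝ≥0∞, Measurable u → (∀ x, u x ≤ 1) →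
      ∫⁻ x, u x = ∫⁻ r in Set.Ioi (0 : ℝ), volume {x | ENNReal.ofReal r < u x} := by
    intro u hu hu1
    have hne : ∀ x, u x ≠ ∞ := fun x => ((hu1 x).trans_lt ENNReal.one_lt_top).ne
    have := lintegral_eq_lintegral_meas_lt (f := fun x => (u x).toReal) volume
      (Filter.Eventually.of_forall fun x => ENNReal.toReal_nonneg) hu.ennreal_toReal.aemeasurable
    simp only [ENNReal.ofReal_toReal (hne _)] at this
    rw [this]
    refine setLIntegral_congr_fun measurableSet_Ioi fun r hr => ?_
    congr 1
    ext x
    exact (ENNReal.ofReal_lt_iff_lt_toReal (le_of_lt hr) (hne x)).symm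
  have hf1 : ∀ x, f x ≤ 1 := fun x => hfA ▸ le_iSup f x
  have hg1 : ∀ x, g x ≤ 1 := fun x => hgB ▸ le_iSup g x
  have hmin : ∫⁻ x, min (h x) 1 ≤ ∫⁻ x, h x := lintegral_mono fun x => min_le_left _ _
  refine le_trans ?_ hmin
  rw [layer f hf hf1, layer g hg hg1,
    layer _ (hh.min measurable_const) fun x => min_le_right _ _,
    ← lintegral_const_mul' _ _ ENNReal.ofReal_ne_top,
    ← lintegral_const_mul' _ _ ENNReal.ofReal_ne_top]
  refine (le_lintegral_add _ _).trans (setLIntegral_mono' measurableSet_Ioi fun r hr => ?_)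
  rcases lt_or_ge (ENNReal.ofReal r) 1 with hr1 | hr1
  · apply ofReal_mul_volume_add_le hs ht (hf measurableSet_Ioi) (hg measurableSet_Ioi)
    · exact lt_iSup_iff.1 (hfA.symm ▸ hr1)
    · exact lt_iSup_iff.1 (hgB.symm ▸ hr1)
    · intro x hx y hy
      refine lt_min ?_ hr1
      refine lt_of_lt_of_le ?_ (H x y)
      have hx' : ENNReal.ofReal r < f x := hx
      have hy' : ENNReal.ofReal r < g y := hy
      calc ENNReal.ofReal r = ENNReal.ofReal r ^ s * ENNReal.ofReal r ^ t := by
            rw [← ENNReal.rpow_add_of_nonneg _ _ hs.le ht.le, hst, ENNReal.rpow_one]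
        _ < f x ^ s * g y ^ t :=
            ENNReal.mul_lt_mul (ENNReal.rpow_lt_rpow hx' hs) (ENNReal.rpow_lt_rpow hy' ht)
  · have e1 : {x | ENNReal.ofReal r < f x} = ∅ := by
      ext x; simpa using (hf1 x).trans hr1
    have e2 : {x | ENNReal.ofReal r < g x} = ∅ := by
      ext x; simpa using (hg1 x).trans hr1
    simp [e1, e2]

/-- The Prékopa–Leindler inequality as a property of a real vector space with a measure. -/
def SatisfiesPrekopaLeindler (E : Type*) [AddCommGroup E] [Module ℝ E] [MeasureSpace E] : Prop :=
  ∀ s t : ℝ, 0 < s → 0 < t → s + t = 1 → ∀ f g h : E → ℝ≥0∞,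
    Measurable f → Measurable g → Measurable h →
    (∀ x y, f x ^ s * g y ^ t ≤ h (s • x + t • y)) →
    (∫⁻ x, f x) ^ s * (∫⁻ x, g x) ^ t ≤ ∫⁻ x, h x

/-- Functions with finite supremum are normalized to have supremum `1`; the arithmetic-geometric
mean inequality turns the additive form into the multiplicative one. -/
theorem prekopaLeindler_real_of_bounded {s t : ℝ} (hs : 0 < s) (ht : 0 < t) (hst : s + t = 1)
    {f g h : ℝ → ℝ≥0∞} (hf : Measurable f) (hg : Measurable g) (hh : Measurable h)
    (hfA : ⨆ x, f x ≠ ∞) (hgB : ⨆ x, g x ≠ ∞)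
    (H : ∀ x y, f x ^ s * g y ^ t ≤ h (s * x + t * y)) :
    (∫⁻ x, f x) ^ s * (∫⁻ x, g x) ^ t ≤ ∫⁻ x, h x := by
  set A := ⨆ x, f x with hA
  set B := ⨆ x, g x with hB
  rcases eq_or_ne A 0 with hA0 | hA0
  · have : ∀ x, f x = 0 := fun x => le_antisymm ((le_iSup f x).trans hA0.le) zero_le
    simp [this, ENNReal.zero_rpow_of_pos hs]
  rcases eq_or_ne B 0 with hB0 | hB0
  · have : ∀ x, g x = 0 := fun x => le_antisymm ((le_iSup g x).trans hB0.le) zero_le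
    simp [this, ENNReal.zero_rpow_of_pos ht]
  have key := lintegral_add_le_of_iSup_eq_one hs ht hst (f := fun x => A⁻¹ * f x)
    (g := fun x => B⁻¹ * g x) (h := fun x => A⁻¹ ^ s * B⁻¹ ^ t * h x)
    (hf.const_mul _) (hg.const_mul _) (hh.const_mul _)
    (by rw [← ENNReal.mul_iSup, ENNReal.inv_mul_cancel hA0 hfA])
    (by rw [← ENNReal.mul_iSup, ENNReal.inv_mul_cancel hB0 hgB])
    (by
      intro x y
      rw [ENNReal.mul_rpow_of_nonneg _ _ hs.le, ENNReal.mul_rpow_of_nonneg _ _ ht.le,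
        mul_mul_mul_comm]
      gcongr
      exact H x y)
  rw [lintegral_const_mul _ hf, lintegral_const_mul _ hg, lintegral_const_mul _ hh] at key
  have key2 := (ENNReal.rpow_mul_rpow_le_add hs ht hst _ _).trans key
  rw [ENNReal.mul_rpow_of_nonneg _ _ hs.le, ENNReal.mul_rpow_of_nonneg _ _ ht.le,
    mul_mul_mul_comm] at key2
  refine (ENNReal.mul_le_mul_iff_right ?_ ?_).1 key2
  · refine mul_ne_zero ?_ ?_ <;>
      simp [ENNReal.rpow_eq_zero_iff, hfA, hgB, hs.not_gt, ht.not_gt, hA0, hB0]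
  · refine ENNReal.mul_ne_top ?_ ?_ <;>
      exact ENNReal.rpow_ne_top_of_nonneg (by positivity) (by simpa)

theorem satisfiesPrekopaLeindler_real : SatisfiesPrekopaLeindler ℝ := by
  intro s t hs ht hst f g h hf hg hh H
  -- Truncate at height `N` and let `N` tend to infinity.
  have hfin : ∀ (u : ℝ → ℝ≥0∞) (N : ℕ), ⨆ x, min (u x) N ≠ ∞ := fun u N =>
    ((iSup_le fun x => min_le_right _ _).trans_lt (ENNReal.natCast_lt_top N)).ne
  have bound : ∀ N : ℕ, (∫⁻ x, min (f x) N) ^ s * (∫⁻ x, min (g x) N) ^ t ≤ ∫⁻ x, h x := by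
    intro N
    refine prekopaLeindler_real_of_bounded hs ht hst (hf.min measurable_const)
      (hg.min measurable_const) hh (hfin f N) (hfin g N) fun x y => le_trans ?_ (H x y)
    gcongr <;> exact min_le_left _ _
  have lim : ∀ u : ℝ → ℝ≥0∞, Measurable u →
      Filter.Tendsto (fun N : ℕ => ∫⁻ x, min (u x) N) Filter.atTop (nhds (∫⁻ x, u x)) := by
    intro u hu
    refine lintegral_tendsto_of_tendsto_of_monotone
      (fun N => (hu.min measurable_const).aemeasurable)
      (Filter.Eventually.of_forall fun x M N hMN => by
        dsimp only; gcongr) ?_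
    refine Filter.Eventually.of_forall fun x => ?_
    have := (tendsto_const_nhds (x := u x) (f := Filter.atTop (α := ℕ))).min
      ENNReal.tendsto_nat_nhds_top
    simpa using this
  rcases eq_or_ne (∫⁻ x, f x) 0 with hf0 | hf0
  · simp [hf0, ENNReal.zero_rpow_of_pos hs]
  rcases eq_or_ne (∫⁻ x, g x) 0 with hg0 | hg0
  · simp [hg0, ENNReal.zero_rpow_of_pos ht]
  refine le_of_tendsto (ENNReal.Tendsto.mul ((lim f hf).ennrpow_const s) (Or.inl ?_)
    ((lim g hg).ennrpow_const t) (Or.inl ?_)) (Filter.Eventually.of_forall bound)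
  · simp [ENNReal.rpow_eq_zero_iff, hf0, hs.not_gt]
  · simp [ENNReal.rpow_eq_zero_iff, hg0, ht.not_gt]

/-- The marginals on `E` of functions on `E × F` inherit the hypothesis of the inequality, by the
inequality on `F`. -/
theorem SatisfiesPrekopaLeindler.prod {E F : Type*} [AddCommGroup E] [Module ℝ E] [MeasureSpace E]
    [AddCommGroup F] [Module ℝ F] [MeasureSpace F] [SFinite (volume : Measure F)]
    (hE : SatisfiesPrekopaLeindler E) (hF : SatisfiesPrekopaLeindler F) :
    SatisfiesPrekopaLeindler (E × F) := by
  intro s t hs ht hst f g h hf hg hh H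
  rw [Measure.volume_eq_prod, lintegral_prod _ hf.aemeasurable, lintegral_prod _ hg.aemeasurable,
    lintegral_prod _ hh.aemeasurable]
  refine hE s t hs ht hst _ _ _ hf.lintegral_prod_right' hg.lintegral_prod_right'
    hh.lintegral_prod_right' fun x y => ?_
  exact hF s t hs ht hst _ _ _ (hf.comp measurable_prodMk_left) (hg.comp measurable_prodMk_left)
    (hh.comp measurable_prodMk_left) fun u v => H (x, u) (y, v)

theorem satisfiesPrekopaLeindler_pi : ∀ m : ℕ, SatisfiesPrekopaLeindler (Fin m → ℝ)
  | 0 => by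
    intro s t hs ht hst f g h hf hg hh H
    have hvol : (volume : Measure (Fin 0 → ℝ)) = Measure.dirac 0 := by
      rw [volume_pi, Measure.pi_of_empty _ 0]
    rw [hvol, lintegral_dirac, lintegral_dirac, lintegral_dirac]
    simpa using H 0 0
  | m + 1 => by
    intro s t hs ht hst f g h hf hg hh H
    let e := (MeasurableEquiv.piFinSuccAbove (fun _ : Fin (m + 1) => ℝ) 0).symm
    have he : MeasurePreserving e volume volume :=
      (volume_preserving_piFinSuccAbove (fun _ : Fin (m + 1) => ℝ) 0).symm _
    rw [← he.lintegral_comp_emb e.measurableEmbedding, ← he.lintegral_comp_emb e.measurableEmbedding,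
      ← he.lintegral_comp_emb e.measurableEmbedding]
    refine (satisfiesPrekopaLeindler_real.prod (satisfiesPrekopaLeindler_pi m)) s t hs ht hst _ _ _
      (hf.comp e.measurable) (hg.comp e.measurable) (hh.comp e.measurable) fun x y => ?_
    convert H (e x) (e y) using 2
    ext i
    refine Fin.cases ?_ (fun j => ?_) i <;>
      simp [e, MeasurableEquiv.piFinSuccAbove, Fin.insertNthEquiv]

/-- The multiplicative Brunn–Minkowski inequality. -/
theorem SatisfiesPrekopaLeindler.volume_rpow_mul_le {E : Type*} [AddCommGroup E] [Module ℝ E]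
    [MeasureSpace E] (hE : SatisfiesPrekopaLeindler E) {s t : ℝ} (hs : 0 < s) (ht : 0 < t)
    (hst : s + t = 1) {A B Z : Set E} (hA : MeasurableSet A) (hB : MeasurableSet B)
    (hZ : MeasurableSet Z) (H : ∀ x ∈ A, ∀ y ∈ B, s • x + t • y ∈ Z) :
    volume A ^ s * volume B ^ t ≤ volume Z := by
  have := hE s t hs ht hst (A.indicator 1) (B.indicator 1) (Z.indicator 1)
    (measurable_one.indicator hA) (measurable_one.indicator hB) (measurable_one.indicator hZ) (by
      intro x y
      by_cases hx : x ∈ A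
      · by_cases hy : y ∈ B
        · simp [hx, hy, H x hx y hy]
        · simp [hy, ENNReal.zero_rpow_of_pos ht]
      · simp [hx, ENNReal.zero_rpow_of_pos hs])
  simpa [lintegral_indicator_one, hA, hB, hZ] using this

/-! ### Slabs of a convex body -/

theorem Convex.homothety_mem {E : Type*} [AddCommGroup E] [Module ℝ E] {C : Set E}
    (hC : Convex ℝ C) {p y : E} (hp : p ∈ C) (hy : y ∈ C) {r : ℝ}
    (hr : 0 ≤ r) (hr1 : r ≤ 1) : r • (y - p) + p ∈ C := by
  have := hC hy hp hr (sub_nonneg.2 hr1) (by ring)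
  convert this using 1
  module

section ConvexBody

set_option linter.unusedSectionVars false

variable {E : Type*} [NormedAddCommGroup E] [NormedSpace ℝ E] [FiniteDimensional ℝ E]
  [MeasureSpace E] [BorelSpace E] [(volume : Measure E).IsAddHaarMeasure]

/-- The volume of the part of `C` on which the functional `φ` is at least `h`. -/
noncomputable def capVolume (C : Set E) (φ : E →L[ℝ] ℝ) (h : ℝ) : ℝ :=
  volume.real (C ∩ {y | h ≤ φ y})

variable {C : Set E} {φ : E →L[ℝ] ℝ}

theorem measurableSet_cap (hC : IsCompact C) (h : ℝ) : MeasurableSet (C ∩ {y | h ≤ φ y}) :=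
  hC.measurableSet.inter (measurableSet_le measurable_const φ.continuous.measurable)

theorem volume_inter_ne_top (hC : IsCompact C) (A : Set E) : volume (C ∩ A) ≠ ∞ :=
  measure_ne_top_of_subset Set.inter_subset_left hC.measure_ne_top

theorem capVolume_antitone (hC : IsCompact C) : Antitone (capVolume C φ) := fun _ _ hab =>
  measureReal_mono (fun _ hy => ⟨hy.1, hab.trans hy.2⟩) (volume_inter_ne_top hC _)

theorem volumeReal_inter_lt (hC : IsCompact C) (h : ℝ) :
    volume.real (C ∩ {y | φ y < h}) = volume.real C - capVolume C φ h := by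
  have := measureReal_inter_add_sdiff (μ := volume) (s := C)
    (measurableSet_le measurable_const φ.continuous.measurable : MeasurableSet {y | h ≤ φ y})
    (h := hC.measure_ne_top)
  have e : C \ {y | h ≤ φ y} = C ∩ {y | φ y < h} := by
    ext y; simp
  rw [e] at this
  unfold capVolume
  linarith

theorem pow_mul_volume_le_of_homothety_mem {A B : Set E} {p : E} {r : ℝ} (hr : 0 ≤ r)
    (h : ∀ y ∈ A, r • (y - p) + p ∈ B) :
    ENNReal.ofReal (r ^ Module.finrank ℝ E) * volume A ≤ volume B := by
  rw [← abs_of_nonneg (pow_nonneg hr (Module.finrank ℝ E)),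
    ← Measure.addHaar_image_homothety volume p r A]
  refine measure_mono ?_
  rintro _ ⟨y, hy, rfl⟩
  exact h y hy

theorem pow_mul_volumeReal_le_of_homothety_mem {A B : Set E} {p : E} {r : ℝ} (hr : 0 ≤ r)
    (hB : volume B ≠ ∞) (h : ∀ y ∈ A, r • (y - p) + p ∈ B) :
    r ^ Module.finrank ℝ E * volume.real A ≤ volume.real B := by
  have := ENNReal.toReal_mono hB (pow_mul_volume_le_of_homothety_mem hr h)
  rwa [ENNReal.toReal_mul, ENNReal.toReal_ofReal (by positivity)] at this

/-- A slab of thickness `s` has volume at most about `m s / L` times that of the body, where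
`L = φ q - φ p` (the width, for extremal `p` and `q`) and `m` is the dimension. Shrinking the body
towards `q` moves the part above the bottom of the slab to the part above its top, and shrinking
towards `p` moves the part below the top to the part below the bottom; adding the two resulting bounds makes the
position of the slab irrelevant. -/
theorem capVolume_sub_capVolume_mul_le (hC : IsCompact C) (hconv : Convex ℝ C)
    (hm : 1 ≤ Module.finrank ℝ E) {p q : E} (hp : p ∈ C) (hq : q ∈ C)
    {α s : ℝ} (hs : 0 ≤ s) (hαp : φ p ≤ α) (hαq : α ≤ φ q) :
    (capVolume C φ α - capVolume C φ (α + s)) * (φ q - φ p + s - Module.finrank ℝ E * s)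
      ≤ Module.finrank ℝ E * s * volume.real C := by
  set m := Module.finrank ℝ E
  set T := capVolume C φ α - capVolume C φ (α + s) with hT
  have hm' : (1 : ℝ) ≤ m := by exact_mod_cast hm
  have hT0 : 0 ≤ T := sub_nonneg.2 (capVolume_antitone hC (by linarith))
  -- If `μ` is the volume of a region containing the slab, and shrinking by `1 - s / D` maps this
  -- region into its part outside the slab, then Bernoulli's inequality bounds the slab.
  have bernoulli : ∀ D μ : ℝ, 0 ≤ D → 0 ≤ μ → T ≤ μ →
      (s < D → (1 - s / D) ^ m * μ ≤ μ - T) → D * T ≤ m * s * μ := by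
    intro D μ hD hμ hTμ h
    rcases lt_or_ge s D with hsD | hsD
    · have hDpos : 0 < D := hs.trans_lt hsD
      have h1 : s / D ≤ 1 := (div_le_one hDpos).2 hsD.le
      have h2 := one_add_mul_le_pow (a := -(s / D)) (by linarith) m
      have h3 : (1 - m * (s / D)) * μ ≤ μ - T := by
        refine le_trans (mul_le_mul_of_nonneg_right ?_ hμ) (h hsD)
        rw [sub_eq_add_neg 1 (s / D)]
        linarith
      have h4 : T ≤ m * (s / D) * μ := by linarith
      calc D * T ≤ D * (m * (s / D) * μ) := by gcongr
        _ = m * s * μ := by field_simp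
    · calc D * T ≤ s * μ := by gcongr
        _ ≤ m * s * μ := by
          rw [mul_assoc]; exact le_mul_of_one_le_left (by positivity) hm'
  have upper : (φ q - α) * T ≤ m * s * capVolume C φ α := by
    refine bernoulli _ _ (by linarith) measureReal_nonneg ?_ fun hsD => ?_
    · have : 0 ≤ capVolume C φ (α + s) := measureReal_nonneg
      linarith
    · have hD : 0 < φ q - α := hs.trans_lt hsD
      have h1 : s / (φ q - α) ≤ 1 := (div_le_one hD).2 hsD.le
      have h0 : 0 ≤ s / (φ q - α) := by positivity
      have := pow_mul_volumeReal_le_of_homothety_mem (A := C ∩ {y | α ≤ φ y})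
        (B := C ∩ {y | α + s ≤ φ y}) (p := q) (sub_nonneg.2 h1) (volume_inter_ne_top hC _) (by
          rintro y ⟨hyC, hy⟩
          refine ⟨hconv.homothety_mem hq hyC (sub_nonneg.2 h1) (by linarith), ?_⟩
          simp only [Set.mem_ofPred_eq, map_add, map_smul, map_sub, smul_eq_mul] at hy ⊢
          have h5 : (1 - s / (φ q - α)) * (φ y - φ q) ≥ (1 - s / (φ q - α)) * (α - φ q) :=
            mul_le_mul_of_nonneg_left (by linarith) (by linarith)
          have h6 : (1 - s / (φ q - α)) * (α - φ q) = α - φ q + s := by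
            field_simp
            ring
          linarith)
      unfold capVolume at hT ⊢
      linarith
  have lower : (α + s - φ p) * T ≤ m * s * (volume.real C - capVolume C φ (α + s)) := by
    have hα : 0 ≤ volume.real C - capVolume C φ α := by
      rw [← volumeReal_inter_lt hC]; exact measureReal_nonneg
    refine bernoulli _ _ (by linarith) (by linarith) (by linarith) fun hsD => ?_
    have hD : 0 < α + s - φ p := hs.trans_lt hsD
    have h1 : s / (α + s - φ p) < 1 := (div_lt_one hD).2 hsD
    have h0 : 0 ≤ s / (α + s - φ p) := by positivity
    have := pow_mul_volumeReal_le_of_homothety_mem (A := C ∩ {y | φ y < α + s})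
      (B := C ∩ {y | φ y < α}) (p := p) (sub_nonneg.2 h1.le) (volume_inter_ne_top hC _) (by
        rintro y ⟨hyC, hy⟩
        refine ⟨hconv.homothety_mem hp hyC (sub_nonneg.2 h1.le) (by linarith), ?_⟩
        simp only [Set.mem_ofPred_eq, map_add, map_smul, map_sub, smul_eq_mul] at hy ⊢
        have h5 : (1 - s / (α + s - φ p)) * (φ y - φ p)
            < (1 - s / (α + s - φ p)) * (α + s - φ p) :=
          mul_lt_mul_of_pos_left (by linarith) (by linarith)
        have h6 : (1 - s / (α + s - φ p)) * (α + s - φ p) = α - φ p := by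
          field_simp
          ring
        linarith)
    rw [volumeReal_inter_lt hC, volumeReal_inter_lt hC] at this
    linarith
  have hsum : m * s * capVolume C φ α + m * s * (volume.real C - capVolume C φ (α + s))
      = m * s * (volume.real C + T) := by rw [hT]; ring
  nlinarith

/-! ### Grünbaum's inequality -/

theorem capVolume_rpow_mul_le (hPL : SatisfiesPrekopaLeindler E) (hC : IsCompact C)
    (hconv : Convex ℝ C) {s t : ℝ} (hs : 0 < s) (ht : 0 < t) (hst : s + t = 1) (a b : ℝ) :
    capVolume C φ a ^ s * capVolume C φ b ^ t ≤ capVolume C φ (s * a + t * b) := by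
  have := hPL.volume_rpow_mul_le hs ht hst (measurableSet_cap (φ := φ) hC a)
    (measurableSet_cap (φ := φ) hC b) (measurableSet_cap (φ := φ) hC (s * a + t * b)) (by
      rintro x ⟨hx, hax⟩ y ⟨hy, hby⟩
      refine ⟨hconv hx hy hs.le ht.le hst, ?_⟩
      simp only [Set.mem_ofPred_eq, map_add, map_smul, smul_eq_mul] at hax hby ⊢
      gcongr)
  have := ENNReal.toReal_mono (volume_inter_ne_top hC _) this
  rwa [ENNReal.toReal_mul, ← ENNReal.toReal_rpow, ← ENNReal.toReal_rpow] at this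

theorem ConcaveOn.exists_le_sub_mul {b x : ℝ} {f : ℝ → ℝ} (hf : ConcaveOn ℝ (Set.Iio b) f)
    (hx : x < b) : ∃ κ : ℝ, ∀ y < b, f y ≤ f x - κ * (y - x) := by
  have hg := hf.neg
  have hxi : x ∈ interior (Set.Iio b) := by simpa using hx
  refine ⟨derivWithin (-f) (Set.Ioi x) x, fun y hy => ?_⟩
  rcases lt_trichotomy x y with h | rfl | h
  · have := hg.rightDeriv_le_slope_of_mem_interior hxi hy h
    rw [slope_def_field, le_div_iff₀ (by linarith)] at this
    simp only [Pi.neg_apply] at this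
    linarith
  · simp
  · have := (hg.slope_le_leftDeriv_of_mem_interior hy hxi h).trans
      (hg.leftDeriv_le_rightDeriv_of_mem_interior hxi)
    rw [slope_def_field, div_le_iff₀ (by linarith)] at this
    simp only [Pi.neg_apply] at this
    linarith

/-- The cap volume is log-concave, so it lies below an exponential touching it at `α`. -/
theorem exists_capVolume_le_mul_exp (hPL : SatisfiesPrekopaLeindler E) (hC : IsCompact C)
    (hconv : Convex ℝ C) (hV : 0 < volume.real C) {p q : E} (hq : q ∈ C)
    (hpmin : ∀ y ∈ C, φ p ≤ φ y) (hqmax : ∀ y ∈ C, φ y ≤ φ q) (hpq : φ p < φ q)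
    {α : ℝ} (hα : α < φ q) :
    ∃ κ : ℝ, ∀ h, capVolume C φ h ≤ capVolume C φ α * Real.exp (-(κ * (h - α))) := by
  have anti := capVolume_antitone (φ := φ) hC
  have pos : ∀ h < φ q, 0 < capVolume C φ h := by
    intro h hh
    have hD : 0 < φ q - φ p := sub_pos.2 hpq
    set r := min 1 ((φ q - h) / (φ q - φ p)) with hr
    have hr0 : 0 < r := lt_min one_pos (div_pos (sub_pos.2 hh) hD)
    have hrh : r * (φ q - φ p) ≤ φ q - h := (le_div_iff₀ hD).1 (min_le_right _ _)
    refine lt_of_lt_of_le (by positivity) (pow_mul_volumeReal_le_of_homothety_mem (A := C)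
      (p := q) hr0.le (volume_inter_ne_top hC _) fun y hy =>
        ⟨hconv.homothety_mem hq hy hr0.le (min_le_left _ _), ?_⟩)
    simp only [Set.mem_ofPred_eq, map_add, map_smul, map_sub, smul_eq_mul]
    have := mul_le_mul_of_nonneg_left (sub_le_sub_left (hpmin y hy) (φ q)) hr0.le
    linarith
  have conc : ConcaveOn ℝ (Set.Iio (φ q)) fun h => Real.log (capVolume C φ h) := by
    refine ⟨convex_Iio _, fun a ha b hb s t hs ht hst => ?_⟩
    rcases hs.eq_or_lt with rfl | hs
    · obtain rfl : t = 1 := by linarith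
      simp
    rcases ht.eq_or_lt with rfl | ht
    · obtain rfl : s = 1 := by linarith
      simp
    have ha' := pos a ha
    have hb' := pos b hb
    simp only [smul_eq_mul]
    rw [← Real.log_rpow ha', ← Real.log_rpow hb', ← Real.log_mul (by positivity) (by positivity)]
    exact Real.log_le_log (by positivity) (capVolume_rpow_mul_le hPL hC hconv hs ht hst a b)
  obtain ⟨κ, hκ⟩ := conc.exists_le_sub_mul hα
  have below : ∀ h < φ q,
      capVolume C φ h ≤ capVolume C φ α * Real.exp (-(κ * (h - α))) := by
    intro h hh
    have := Real.exp_le_exp.2 (hκ h hh)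
    rwa [Real.exp_log (pos h hh), sub_eq_add_neg, Real.exp_add, Real.exp_log (pos α hα)] at this
  refine ⟨κ, fun h => ?_⟩
  rcases lt_trichotomy h (φ q) with hh | rfl | hh
  · exact below h hh
  · have hc : Continuous fun h => capVolume C φ α * Real.exp (-(κ * (h - α))) := by fun_prop
    refine ge_of_tendsto (hc.continuousWithinAt (s := Set.Iio (φ q)) (x := φ q)) ?_
    filter_upwards [self_mem_nhdsWithin] with h hh
    exact (anti (le_of_lt hh)).trans (below h hh)
  · have : C ∩ {y | h ≤ φ y} = ∅ := by
      ext y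
      simpa using fun hy => (hqmax y hy).trans_lt hh
    rw [capVolume, this, measureReal_empty]
    have := (pos α hα).le
    positivity

/-- **Grünbaum's inequality**: a halfspace through the centroid `c` of a convex body contains at
least the fraction `1 / e` of its volume. For a random point `X` of the body, `W = κ (φ X - φ c)`
has mean zero and, by log-concavity, `W - log g` has a tail below `exp (-s)`, where `g` is the
fraction in question; so `-log g`, which is the mean of `W - log g`, is at most `1`. -/
theorem volumeReal_le_exp_mul_capVolume (hPL : SatisfiesPrekopaLeindler E) (hC : IsCompact C)
    (hconv : Convex ℝ C) (hV : 0 < volume.real C) {p q : E} (hp : p ∈ C) (hq : q ∈ C)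
    (hpmin : ∀ y ∈ C, φ p ≤ φ y) (hqmax : ∀ y ∈ C, φ y ≤ φ q) (hpq : φ p < φ q) {c : E}
    (hc : c ∈ C) (hint : ∫ y in C, φ y = volume.real C * φ c) :
    volume.real C ≤ Real.exp 1 * capVolume C φ (φ c) := by
  have hintφ : IntegrableOn (fun y => φ y) C := φ.continuous.continuousOn.integrableOn_compact hC
  have hconst : ∀ r : ℝ, IntegrableOn (fun _ : E => r) C := fun r =>
    integrableOn_const hC.measure_ne_top
  have hcap_p : capVolume C φ (φ p) = volume.real C := by
    unfold capVolume
    congr 1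
    ext y
    simpa using hpmin y
  have hα : φ c < φ q := by
    refine (hqmax c hc).lt_of_ne fun hcq => ?_
    have hnull : volume.real (C ∩ {y | φ y < φ q}) = 0 := by
      have h0 : ∫ y in C, (φ q - φ y) = 0 := by
        rw [integral_sub (hconst _) hintφ, hint, hcq]
        simp
      rw [setIntegral_eq_zero_iff_of_nonneg_ae ((ae_restrict_iff' hC.measurableSet).2
        (Filter.Eventually.of_forall fun y hy => sub_nonneg.2 (hqmax y hy)))
        ((hconst _).sub hintφ), Filter.EventuallyEq, ae_restrict_iff' hC.measurableSet] at h0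
      rw [measureReal_eq_zero_iff (volume_inter_ne_top hC _)]
      refine measure_mono_null ?_ (ae_iff.1 h0)
      rintro y ⟨hy, hlt⟩
      simp only [Set.mem_ofPred_eq, Pi.zero_apply, Classical.not_imp] at hlt ⊢
      exact ⟨hy, by linarith⟩
    have := pow_mul_volumeReal_le_of_homothety_mem (A := C) (B := C ∩ {y | φ y < φ q})
      (p := p) (r := 1 / 2) (by norm_num) (volume_inter_ne_top hC _) fun y hy =>
        ⟨hconv.homothety_mem hp hy (by norm_num) (by norm_num), by
          simp only [Set.mem_ofPred_eq, map_add, map_smul, map_sub, smul_eq_mul]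
          linarith [hqmax y hy]⟩
    rw [hnull] at this
    exact absurd this (not_le.2 (by positivity))
  obtain ⟨κ, hκ⟩ := exists_capVolume_le_mul_exp hPL hC hconv hV hq hpmin hqmax hpq hα
  set g := capVolume C φ (φ c) with hg
  have hV' : volume.real C ≤ g * Real.exp (-(κ * (φ p - φ c))) := hcap_p ▸ hκ (φ p)
  have hgpos : 0 < g := by
    by_contra hcon
    have : g * Real.exp (-(κ * (φ p - φ c))) ≤ 0 :=
      mul_nonpos_of_nonpos_of_nonneg (not_lt.1 hcon) (Real.exp_pos _).le
    linarith
  rcases le_or_gt κ 0 with hκ0 | hκ0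
  · have h1 : Real.exp (-(κ * (φ p - φ c))) ≤ 1 := by
      rw [Real.exp_le_one_iff]
      have := mul_nonneg_of_nonpos_of_nonpos hκ0 (sub_nonpos.2 (hpmin c hc))
      linarith
    have h2 : (1 : ℝ) ≤ Real.exp 1 := Real.one_le_exp zero_le_one
    nlinarith
  set θ := Real.log (volume.real C / g) with hθ
  let W : E → ℝ := fun y => κ * (φ y - φ c) + θ
  have hWint : IntegrableOn W C := ((hintφ.sub (hconst _)).const_mul κ).add (hconst _)
  have hWmean : ∫ y in C, W y = θ * volume.real C := by
    have : ∀ y, W y = κ * φ y + (θ - κ * φ c) := fun y => by simp only [W]; ring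
    simp_rw [this]
    rw [integral_add (hintφ.const_mul κ) (hconst _), integral_const_mul, hint]
    simp
    ring
  have htail : ∀ s : ℝ, (volume.restrict C).real {y | s < max (W y) 0} ≤
      volume.real C * Real.exp (-s) := by
    intro s
    rcases lt_or_ge s 0 with hs | hs
    · refine (measureReal_mono (Set.subset_univ _) (by simpa using hC.measure_ne_top)).trans ?_
      rw [measureReal_restrict_apply_univ]
      exact le_mul_of_one_le_right hV.le (Real.one_le_exp (by linarith))
    have hmeas : MeasurableSet {y | s < max (W y) 0} :=
      measurableSet_lt measurable_const (by fun_prop)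
    rw [measureReal_restrict_apply hmeas]
    calc volume.real ({y | s < max (W y) 0} ∩ C)
        ≤ capVolume C φ (φ c + (s - θ) / κ) := by
          refine measureReal_mono ?_ (volume_inter_ne_top hC _)
          rintro y ⟨hy, hyC⟩
          refine ⟨hyC, ?_⟩
          have hsW : s < W y := (lt_max_iff.1 hy).resolve_right hs.not_gt
          have : (s - θ) / κ ≤ φ y - φ c := by
            rw [div_le_iff₀ hκ0]
            simp only [W] at hsW
            linarith
          simp only [Set.mem_ofPred_eq]
          linarith
      _ ≤ g * Real.exp (-(κ * (φ c + (s - θ) / κ - φ c))) := hκ _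
      _ = g * (Real.exp θ * Real.exp (-s)) := by
          rw [← Real.exp_add]
          congr 2
          field_simp
          ring
      _ = volume.real C * Real.exp (-s) := by
          rw [hθ, Real.exp_log (by positivity)]
          field_simp
  have hle : θ * volume.real C ≤ volume.real C := by
    calc θ * volume.real C = ∫ y in C, W y := hWmean.symm
      _ ≤ ∫ y in C, max (W y) 0 := integral_mono hWint hWint.pos_part fun y => le_max_left _ _
      _ = ∫ s in Set.Ioi 0, (volume.restrict C).real {y | s < max (W y) 0} :=
          hWint.pos_part.integral_eq_integral_meas_lt
            (Filter.Eventually.of_forall fun y => le_max_right _ _)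
      _ ≤ ∫ s in Set.Ioi (0 : ℝ), volume.real C * Real.exp (-s) :=
          integral_mono_of_nonneg (Filter.Eventually.of_forall fun s => measureReal_nonneg)
            ((integrableOn_exp_neg_Ioi 0).const_mul _) (Filter.Eventually.of_forall htail)
      _ = volume.real C := by rw [integral_const_mul, integral_exp_neg_Ioi_zero, mul_one]
  have hθ1 : θ ≤ 1 := by
    by_contra hcon
    nlinarith
  have := (Real.log_le_iff_le_exp (by positivity)).1 hθ1
  rwa [div_le_iff₀ hgpos] at this

end ConvexBody

/-! ### Mixed-integer volume versus volume -/

theorem fiber_inter_mixedLattice_inter {n d : ℕ} (C H : Set (MixedSpace n d)) (z : Fin n → ℤ) :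
    fiber (C ∩ mixedLattice n d ∩ H) (intVec z) = fiber (C ∩ H) (intVec z) := by
  ext x
  have : (intVec z, x) ∈ mixedLattice n d := ⟨z, rfl⟩
  simp only [fiber, Set.mem_ofPred_eq, Set.mem_inter_iff]
  tauto

theorem mixedIntegerVolume_inter_mixedLattice_inter {n d : ℕ} (C H : Set (MixedSpace n d)) :
    mixedIntegerVolume (C ∩ mixedLattice n d ∩ H) = mixedIntegerVolume (C ∩ H) := by
  simp_rw [mixedIntegerVolume, fiber_inter_mixedLattice_inter]

theorem mixedIntegerVolume_inter_mixedLattice {n d : ℕ} (C : Set (MixedSpace n d)) :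
    mixedIntegerVolume (C ∩ mixedLattice n d) = mixedIntegerVolume C := by
  simpa using mixedIntegerVolume_inter_mixedLattice_inter C Set.univ

/-- The half-open unit cube centred at the origin, whose integer translates tile `ℝ^n`. -/
def unitCube (n : ℕ) : Set (Fin n → ℝ) := Set.univ.pi fun _ => Set.Ico (-(1 / 2)) (1 / 2)

theorem volume_unitCube (n : ℕ) : volume (unitCube n) = 1 := by
  rw [unitCube, Real.volume_pi_Ico]
  norm_num

theorem measurableSet_unitCube (n : ℕ) : MeasurableSet (unitCube n) :=
  MeasurableSet.univ_pi fun _ => measurableSet_Ico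

theorem abs_le_of_mem_unitCube {n : ℕ} {u : Fin n → ℝ} (hu : u ∈ unitCube n) (i : Fin n) :
    |u i| ≤ 1 / 2 := by
  have := hu i (Set.mem_univ i)
  exact abs_le.2 ⟨this.1, this.2.le⟩

theorem lintegral_eq_tsum_unitCube {n : ℕ} (F : (Fin n → ℝ) → ℝ≥0∞) :
    ∫⁻ w, F w = ∑' z : Fin n → ℤ, ∫⁻ u in unitCube n, F (intVec z + u) := by
  have hpre : ∀ z : Fin n → ℤ,
      unitCube n = (fun u => intVec z + u) ⁻¹' {w | ∀ i, ⌊w i + 1 / 2⌋ = z i} := by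
    intro z
    ext u
    simp only [unitCube, intVec, Set.mem_pi, Set.mem_univ, true_imp_iff, Set.mem_Ico,
      Set.mem_preimage, Set.mem_ofPred_eq, Pi.add_apply, Int.floor_eq_iff]
    refine forall_congr' fun i => ?_
    constructor <;> rintro ⟨h1, h2⟩ <;> constructor <;> linarith
  have hmeas : ∀ z : Fin n → ℤ, MeasurableSet {w : Fin n → ℝ | ∀ i, ⌊w i + 1 / 2⌋ = z i} := by
    intro z
    simp only [Set.ofPred_forall]
    exact MeasurableSet.iInter fun i =>
      (Int.measurable_floor.comp ((measurable_pi_apply i).add_const _))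
        (measurableSet_singleton (z i))
  have hunion : (⋃ z : Fin n → ℤ, {w : Fin n → ℝ | ∀ i, ⌊w i + 1 / 2⌋ = z i}) = Set.univ :=
    Set.eq_univ_of_forall fun w => Set.mem_iUnion.2 ⟨fun i => ⌊w i + 1 / 2⌋, fun i => rfl⟩
  rw [← setLIntegral_univ, ← hunion, lintegral_iUnion hmeas]
  · refine tsum_congr fun z => ?_
    rw [hpre z]
    exact ((measurePreserving_add_left volume (intVec z)).setLIntegral_comp_preimage_emb
      (measurableEmbedding_addLeft _) F _).symm
  · intro z z' hzz'
    refine Set.disjoint_left.2 fun w hw hw' => hzz' (funext fun i => ?_)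
    exact (hw i).symm.trans (hw' i)

theorem lintegral_comp_smul_add {n : ℕ} (F : (Fin n → ℝ) → ℝ≥0∞) {a : ℝ} (ha : 0 < a)
    (v : Fin n → ℝ) :
    ∫⁻ w, F w = ENNReal.ofReal (a ^ n) * ∫⁻ w, F (a • w + v) := by
  have h1 : ∫⁻ w, F (a • w + v) = ∫⁻ w, F (w + v) ∂(Measure.map (fun w => a • w) volume) :=
    ((measurableEmbedding_const_smul₀ ha.ne').lintegral_map fun w => F (w + v)).symm
  rw [h1, Measure.map_addHaar_smul _ ha.ne', lintegral_smul_measure, lintegral_add_right_eq_self,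
    Module.finrank_fin_fun, smul_eq_mul, ← mul_assoc, ← ENNReal.ofReal_mul (by positivity),
    abs_of_pos (by positivity), mul_inv_cancel₀ (by positivity)]
  simp

theorem volume_eq_lintegral_fiber {n d : ℕ} {A : Set (MixedSpace n d)} (hA : MeasurableSet A) :
    volume A = ∫⁻ w, volume (fiber A w) := by
  rw [Measure.volume_eq_prod, Measure.prod_apply hA]
  rfl

open scoped Pointwise in
theorem pow_mul_volume_fiber_le {n d : ℕ} {A B : Set (MixedSpace n d)} {w w' : Fin n → ℝ} {r : ℝ}
    (hr : 0 ≤ r) (v : Fin d → ℝ) (h : ∀ x, (w, x) ∈ A → (w', r • x + v) ∈ B) :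
    ENNReal.ofReal (r ^ d) * volume (fiber A w) ≤ volume (fiber B w') := by
  have : volume (fiber A w) * ENNReal.ofReal (r ^ d) =
      volume ((fun x => x + v) '' (r • fiber A w)) := by
    rw [Set.image_add_right, measure_preimage_add_right, Measure.addHaar_smul,
      Module.finrank_fin_fun, abs_of_nonneg (by positivity), mul_comm]
  rw [mul_comm, this]
  refine measure_mono ?_
  rintro _ ⟨_, ⟨x, hx, rfl⟩, rfl⟩
  exact h x hx

/-- Let the projection of `C` contain the box of radius `k` around `z₀`. For every `z + u` in the
unit cube around a lattice point `z`, write `z = (1 - l) w + l b`, where `w` is the image of `z + u`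
under the dilation by `(1 - l)⁻¹` centred at `z₀`; then `b = z₀ - l⁻¹ u` lies in the box, so the
fiber of `B` over `z` contains a translate of the fiber of `A` over `w` shrunk by `1 - l`. Averaging
over all cubes gives the bound. -/
theorem volume_le_mixedIntegerVolume {n d : ℕ} {A B C : Set (MixedSpace n d)}
    (hA : MeasurableSet A) {z₀ : Fin n → ℝ} {k l : ℝ} (hl0 : 0 < l) (hl1 : l < 1)
    (hlk : 1 / 2 ≤ l * k)
    (hbox : ∀ u : Fin n → ℝ, (∀ i, |u i| ≤ k) → ∃ x, (z₀ + u, x) ∈ C)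
    (hAB : ∀ y ∈ A, ∀ b ∈ C, (1 - l) • y + l • b ∈ B) :
    ENNReal.ofReal ((1 - l) ^ (n + d)) * volume A ≤ mixedIntegerVolume B := by
  have hr : 0 < 1 - l := by linarith
  set r := 1 - l with hrdef
  rw [volume_eq_lintegral_fiber hA,
    lintegral_comp_smul_add (fun w => volume (fiber A w)) (inv_pos.2 hr) (-(r⁻¹ * l) • z₀),
    ← mul_assoc, ← ENNReal.ofReal_mul (by positivity), pow_add, mul_right_comm, ← mul_pow,
    mul_inv_cancel₀ hr.ne', one_pow, one_mul, ← lintegral_const_mul' _ _ ENNReal.ofReal_ne_top,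
    lintegral_eq_tsum_unitCube, mixedIntegerVolume]
  refine ENNReal.tsum_le_tsum fun z => ?_
  calc _ ≤ ∫⁻ u in unitCube n, volume (fiber B (intVec z)) := by
        refine setLIntegral_mono' (measurableSet_unitCube n) fun u hu => ?_
        obtain ⟨x', hx'⟩ := hbox (-l⁻¹ • u) fun i => by
          have := abs_le_of_mem_unitCube hu i
          simp only [Pi.smul_apply, smul_eq_mul, abs_mul, abs_neg, abs_inv, abs_of_pos hl0]
          rw [inv_mul_le_iff₀ hl0]
          linarith
        refine pow_mul_volume_fiber_le hr.le (l • x') fun x hx => ?_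
        convert hAB _ hx _ hx' using 1
        refine Prod.ext ?_ (by simp)
        ext i
        simp
        field_simp
        ring
    _ = volume (fiber B (intVec z)) := by
        rw [setLIntegral_const, volume_unitCube, mul_one]

/-- The reverse comparison: the fiber of `C` over a lattice point `z`, shrunk by `1 - l`, embeds into
the fiber over every point of the shrunken cube `(1 - l) (z + u) + l z₀`. -/
theorem mixedIntegerVolume_le_volume {n d : ℕ} {C : Set (MixedSpace n d)}
    (hC : MeasurableSet C) (hconv : Convex ℝ C) {z₀ : Fin n → ℝ} {k l : ℝ} (hl0 : 0 < l)
    (hl1 : l < 1) (hlk : 1 / 2 ≤ l * k)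
    (hbox : ∀ u : Fin n → ℝ, (∀ i, |u i| ≤ k) → ∃ x, (z₀ + u, x) ∈ C) :
    ENNReal.ofReal ((1 - l) ^ (n + d)) * mixedIntegerVolume C ≤ volume C := by
  have hr : 0 < 1 - l := by linarith
  rw [volume_eq_lintegral_fiber hC,
    lintegral_comp_smul_add (fun w => volume (fiber C w)) hr (l • z₀), pow_add,
    ENNReal.ofReal_mul (by positivity), mul_assoc]
  refine mul_le_mul_right ?_ _
  rw [lintegral_eq_tsum_unitCube, mixedIntegerVolume, ← ENNReal.tsum_mul_left]
  refine ENNReal.tsum_le_tsum fun z => ?_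
  calc ENNReal.ofReal ((1 - l) ^ d) * volume (fiber C (intVec z))
      = ∫⁻ u in unitCube n, ENNReal.ofReal ((1 - l) ^ d) * volume (fiber C (intVec z)) := by
        rw [setLIntegral_const, volume_unitCube, mul_one]
    _ ≤ _ := by
        refine setLIntegral_mono' (measurableSet_unitCube n) fun u hu => ?_
        obtain ⟨x', hx'⟩ := hbox ((l⁻¹ * (1 - l)) • u) fun i => by
          have := abs_le_of_mem_unitCube hu i
          simp only [Pi.smul_apply, smul_eq_mul, abs_mul, abs_inv, abs_of_pos hl0, abs_of_pos hr]
          rw [mul_assoc, inv_mul_le_iff₀ hl0]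
          nlinarith [abs_nonneg (u i)]
        refine pow_mul_volume_fiber_le hr.le (l • x') fun x hx => ?_
        convert hconv hx hx' hr.le hl0.le (by ring) using 1
        refine Prod.ext ?_ (by simp)
        ext i
        simp
        field_simp
        ring

/-! ### The centerpoint -/

instance isAddHaarMeasure_volume_mixedSpace {n d : ℕ} :
    (volume : Measure (MixedSpace n d)).IsAddHaarMeasure :=
  Measure.prod.instIsAddHaarMeasure volume volume

theorem exists_lt_of_ne_zero_of_interior_nonempty {E : Type*} [NormedAddCommGroup E]
    [NormedSpace ℝ E] {C : Set E} (hC : (interior C).Nonempty) {φ : E →L[ℝ] ℝ} (hφ : φ ≠ 0) :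
    ∃ x ∈ C, ∃ y ∈ C, φ x < φ y := by
  by_contra! hcon
  have hconst : ∀ x ∈ C, ∀ y ∈ C, φ x = φ y := fun x hx y hy =>
    le_antisymm (hcon y hy x hx) (hcon x hx y hy)
  obtain ⟨y₀, hy₀⟩ := hC
  refine hφ (ContinuousLinearMap.ext fun v => ?_)
  have hcont : Filter.Tendsto (fun ε : ℝ => y₀ + ε • v) (nhdsWithin 0 {0}ᶜ) (nhds y₀) := by
    have : Continuous fun ε : ℝ => y₀ + ε • v := by fun_prop
    simpa using (this.tendsto 0).mono_left nhdsWithin_le_nhds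
  obtain ⟨ε, hε, hε0⟩ := ((hcont.eventually (mem_interior_iff_mem_nhds.1 hy₀)).and
    self_mem_nhdsWithin).exists
  have := hconst _ hε _ (interior_subset hy₀)
  have hz : ε * φ v = 0 := by simpa using this
  simpa using (mul_eq_zero.1 hz).resolve_left hε0

/-- The linear functional `y ↦ aᵀ y`. -/
noncomputable def dotFunctional {n d : ℕ} (a : MixedSpace n d) : MixedSpace n d →L[ℝ] ℝ :=
  LinearMap.toContinuousLinearMap
    { toFun := fun y => dotProduct a.1 y.1 + dotProduct a.2 y.2
      map_add' := fun x y => by simp [dotProduct_add]; ring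
      map_smul' := fun r y => by simp [dotProduct_smul]; ring }

theorem dotFunctional_apply {n d : ℕ} (a y : MixedSpace n d) :
    dotFunctional a y = dotProduct a.1 y.1 + dotProduct a.2 y.2 := rfl

theorem dotFunctional_ne_zero {n d : ℕ} {a : MixedSpace n d} (ha : a ≠ 0) :
    dotFunctional a ≠ 0 := by
  intro h
  have h0 : dotProduct a.1 a.1 + dotProduct a.2 a.2 = 0 := by
    rw [← dotFunctional_apply, h]; rfl
  have h1 : 0 ≤ dotProduct a.1 a.1 := Finset.sum_nonneg fun i _ => mul_self_nonneg _
  have h2 : 0 ≤ dotProduct a.2 a.2 := Finset.sum_nonneg fun i _ => mul_self_nonneg _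
  refine ha (Prod.ext ?_ ?_)
  · exact dotProduct_self_eq_zero.1 (by linarith)
  · exact dotProduct_self_eq_zero.1 (by linarith)

/-- The point of the mixed lattice is the centroid `c` with its integer coordinates rounded. The
displacement has first component in `[-1/2, 1/2]^n` and its second component is free, so it can be
taken in `(C - C) / (4 k)`. -/
theorem exists_mem_mixedLattice_near {n d : ℕ} {C : Set (MixedSpace n d)}
    {z₀ : Fin n → ℝ} {k : ℝ} (hk : 0 < k)
    (hbox : ∀ u : Fin n → ℝ, (∀ i, |u i| ≤ k) → ∃ x, (z₀ + u, x) ∈ C) (c : MixedSpace n d) :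
    ∃ y ∈ mixedLattice n d, ∃ b ∈ C, ∃ b' ∈ C, y = c + (4 * k)⁻¹ • (b - b') := by
  let z : Fin n → ℤ := fun i => round (c.1 i)
  have hz : ∀ i, |z i - c.1 i| ≤ 1 / 2 := fun i => by
    rw [abs_sub_comm]; exact abs_sub_round (c.1 i)
  obtain ⟨x, hx⟩ := hbox ((2 * k) • (intVec z - c.1)) fun i => by
    have := hz i
    simp only [Pi.smul_apply, Pi.sub_apply, intVec, smul_eq_mul, abs_mul, abs_two, abs_of_pos hk]
    nlinarith
  obtain ⟨x', hx'⟩ := hbox (-((2 * k) • (intVec z - c.1))) fun i => by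
    have := hz i
    simp only [Pi.neg_apply, abs_neg, Pi.smul_apply, Pi.sub_apply, intVec, smul_eq_mul, abs_mul,
      abs_two, abs_of_pos hk]
    nlinarith
  refine ⟨_, ⟨z, ?_⟩, _, hx, _, hx', rfl⟩
  ext i
  simp
  field_simp
  ring

theorem sub_three_mul_le {E t R : ℝ} (ht : 0 ≤ t) (hE : E < 1 / 2) (htE : 3 * t ≤ E)
    (hR : 1 - t ≤ R) : E - 3 * t ≤ R * (E - 2 * t) * R := by
  have h1 : (1 - t) * (1 - t) ≤ R * R := mul_self_le_mul_self (by linarith) hR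
  have h2 : 1 - 2 * t ≤ R * R := by linarith [mul_self_nonneg t]
  calc E - 3 * t ≤ (1 - 2 * t) * (E - 2 * t) := by nlinarith
    _ ≤ R * R * (E - 2 * t) := mul_le_mul_of_nonneg_right h2 (by linarith)
    _ = R * (E - 2 * t) * R := by ring

/-- A halfspace whose boundary passes above the centroid by at most `1 / (4 k)` of the width of `C`
contains a controlled fraction of the mixed-integer volume. Passing from mixed-integer volume to
volume costs another `1 / (2 k)` of the width and two factors `(1 - 1 / (2 k)) ^ (n + d)`. -/
theorem mixedIntegerVolume_cap_ge {n d : ℕ} (hm : 0 < n + d) {C : Set (MixedSpace n d)}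
    (hC : IsConvexBody C) {z₀ : Fin n → ℝ} {k : ℝ}
    (hbox : ∀ u : Fin n → ℝ, (∀ i, |u i| ≤ k) → ∃ x, (z₀ + u, x) ∈ C)
    (hk : 3 * Real.exp 1 / 2 * ((n : ℝ) + (d : ℝ)) ≤ k) {c : MixedSpace n d} (hcC : c ∈ C)
    (hc : ∀ φ : MixedSpace n d →L[ℝ] ℝ, ∫ y in C, φ y = volume.real C * φ c)
    {φ : MixedSpace n d →L[ℝ] ℝ} (hφ : φ ≠ 0) {b b' : MixedSpace n d} (hb : b ∈ C) (hb' : b' ∈ C) :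
    0 < mixedIntegerVolume (C ∩ {y | φ (c + (4 * k)⁻¹ • (b - b')) ≤ φ y}) ∧
    ENNReal.ofReal (1 / Real.exp 1 - 3 * ((n : ℝ) + (d : ℝ)) / (2 * k)) * mixedIntegerVolume C
      ≤ mixedIntegerVolume (C ∩ {y | φ (c + (4 * k)⁻¹ • (b - b')) ≤ φ y}) := by
  have hm1 : (1 : ℝ) ≤ n + d := by exact_mod_cast hm
  have he : (2 : ℝ) < Real.exp 1 := by linarith [Real.exp_one_gt_d9]
  have hk1 : 3 ≤ k := by nlinarith
  have hk0 : 0 < k := by linarith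
  have hV : 0 < volume.real C := ENNReal.toReal_pos
    (Measure.measure_pos_of_nonempty_interior volume hC.interior_nonempty).ne' hC.isCompact.measure_ne_top
  have hne : C.Nonempty := ⟨c, hcC⟩
  obtain ⟨p, hp, hpmin⟩ := hC.isCompact.exists_isMinOn hne φ.continuous.continuousOn
  obtain ⟨q, hq, hqmax⟩ := hC.isCompact.exists_isMaxOn hne φ.continuous.continuousOn
  replace hpmin : ∀ y ∈ C, φ p ≤ φ y := fun y hy => hpmin hy
  replace hqmax : ∀ y ∈ C, φ y ≤ φ q := fun y hy => hqmax hy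
  have hpq : φ p < φ q := by
    obtain ⟨x, hx, y, hy, hxy⟩ := exists_lt_of_ne_zero_of_interior_nonempty hC.interior_nonempty hφ
    exact (hpmin x hx).trans_lt (hxy.trans_le (hqmax y hy))
  have hfin : Module.finrank ℝ (MixedSpace n d) = n + d := by simp
  set m : ℝ := (n : ℝ) + (d : ℝ) with hmdef
  set L := φ q - φ p with hL
  have hL0 : 0 < L := sub_pos.2 hpq
  set l := (2 * k)⁻¹ with hl
  have hl0 : 0 < l := by positivity
  have hl1 : l < 1 := inv_lt_one_of_one_lt₀ (by linarith)
  have hlk : 1 / 2 ≤ l * k := by rw [hl]; field_simp; rfl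
  set E := (Real.exp 1)⁻¹ with hE
  have hE2 : E < 1 / 2 := by rw [hE]; simpa using inv_strictAnti₀ (by norm_num) he
  have hE0 : 0 < E := by positivity
  -- `t` is the fraction of volume lost per shift by `1 / (2 k)` of the width.
  set t := m * l with ht
  have ht0 : 0 < t := by positivity
  have htE : 3 * t ≤ E := by
    rw [ht, hl, hE, ← mul_assoc, ← div_eq_mul_inv, div_le_iff₀ (by positivity),
      ← div_eq_inv_mul, le_div_iff₀ (by positivity)]
    linarith
  set s := 3 / 2 * (l * L) with hs
  have hs0 : 0 ≤ s := by positivity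
  set G := capVolume C φ (φ c) with hG
  set G' := capVolume C φ (φ c + s) with hG'
  have grun : E * volume.real C ≤ G := by
    have := volumeReal_le_exp_mul_capVolume
      ((satisfiesPrekopaLeindler_pi n).prod (satisfiesPrekopaLeindler_pi d)) hC.isCompact
      hC.convex hV hp hq hpmin hqmax hpq hcC (hc φ)
    rw [hE, inv_mul_le_iff₀ (by positivity)]
    exact this
  have hGG' : 0 ≤ G - G' := sub_nonneg.2 (capVolume_antitone hC.isCompact (by linarith))
  have slab : G - G' ≤ 2 * t * volume.real C := by
    have := capVolume_sub_capVolume_mul_le hC.isCompact hC.convex (by rw [hfin]; exact hm) hp hq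
      hs0 (hpmin c hcC) (hqmax c hcC)
    rw [hfin] at this
    push_cast at this
    have hms : m * s = 3 / 2 * t * L := by rw [hs, ht]; ring
    have h1 : (G - G') * (L * (1 - 3 / 2 * t)) ≤ 3 / 2 * t * L * volume.real C := by
      rw [← hms]
      refine le_trans (mul_le_mul_of_nonneg_left ?_ hGG') this
      rw [← hmdef, hms]
      linarith
    have h2 : (G - G') * (1 - 3 / 2 * t) ≤ 3 / 2 * t * volume.real C := by
      refine le_of_mul_le_mul_left ?_ hL0
      linarith
    have h3 : (3 / 4 : ℝ) ≤ 1 - 3 / 2 * t := by linarith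
    nlinarith
  have hG'V : (E - 2 * t) * volume.real C ≤ G' := by linarith
  have hpos : 0 < E - 2 * t := by linarith
  set R := (1 - l) ^ (n + d) with hR
  have hR0 : 0 < R := pow_pos (by linarith) _
  have hRt : 1 - t ≤ R := by
    have := one_add_mul_le_pow (a := -l) (by linarith) (n + d)
    push_cast at this
    rw [← sub_eq_add_neg] at this
    linarith
  have lower : ENNReal.ofReal (R * G') ≤
      mixedIntegerVolume (C ∩ {y | φ (c + (4 * k)⁻¹ • (b - b')) ≤ φ y}) := by
    have := volume_le_mixedIntegerVolume (measurableSet_cap (φ := φ) hC.isCompact (φ c + s)) hl0 hl1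
      hlk hbox (B := C ∩ {y | φ (c + (4 * k)⁻¹ • (b - b')) ≤ φ y}) (by
        rintro y ⟨hy, hys⟩ v hv
        refine ⟨hC.convex hy hv (by linarith) hl0.le (by ring), ?_⟩
        simp only [Set.mem_ofPred_eq, map_add, map_smul, map_sub, smul_eq_mul] at hys ⊢
        have h1 : (4 * k)⁻¹ * (φ b - φ b') ≤ l / 2 * L := by
          have : (4 * k)⁻¹ = l / 2 := by rw [hl]; field_simp; norm_num
          rw [this]
          refine mul_le_mul_of_nonneg_left ?_ (by positivity)
          linarith [hqmax b hb, hpmin b' hb']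
        have h2 : l * (φ y - φ v) ≤ l * L := by
          refine mul_le_mul_of_nonneg_left ?_ hl0.le
          linarith [hqmax y hy, hpmin v hv]
        linarith)
    rwa [ENNReal.ofReal_mul hR0.le, hG', capVolume, ofReal_measureReal
      (volume_inter_ne_top hC.isCompact _)]
  have upper := mixedIntegerVolume_le_volume hC.isCompact.measurableSet hC.convex hl0 hl1 hlk hbox
  have hG'pos : 0 < G' := lt_of_lt_of_le (by positivity) hG'V
  refine ⟨lt_of_lt_of_le (ENNReal.ofReal_pos.2 (by positivity)) lower, le_trans ?_ lower⟩
  have hcoef : 1 / Real.exp 1 - 3 * m / (2 * k) ≤ R * (E - 2 * t) * R := by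
    have h1 : 1 / Real.exp 1 - 3 * m / (2 * k) = E - 3 * t := by
      rw [hE, ht, hl]; ring
    rw [h1]
    exact sub_three_mul_le ht0.le hE2 htE hRt
  calc ENNReal.ofReal (1 / Real.exp 1 - 3 * m / (2 * k)) * mixedIntegerVolume C
      ≤ ENNReal.ofReal (R * (E - 2 * t) * R) * mixedIntegerVolume C := by gcongr
    _ = ENNReal.ofReal (R * (E - 2 * t)) * (ENNReal.ofReal R * mixedIntegerVolume C) := by
        rw [ENNReal.ofReal_mul (by positivity), mul_assoc]
    _ ≤ ENNReal.ofReal (R * (E - 2 * t)) * volume C := by gcongr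
    _ = ENNReal.ofReal (R * ((E - 2 * t) * volume.real C)) := by
        rw [← ofReal_measureReal hC.isCompact.measure_ne_top, ← ENNReal.ofReal_mul (by positivity),
          mul_assoc]
    _ ≤ ENNReal.ofReal (R * G') := by gcongr

theorem theorem1 (n d : ℕ) (hn : 0 < n) (hd : 0 < d)
    (C S : Set (MixedSpace n d)) (hC : IsConvexBody C) (hS : S = C ∩ mixedLattice n d)
    (z₀ : Fin n → ℝ) (k : ℝ)
    (hbox : (fun u : Fin n → ℝ => z₀ + k • u) '' linftyBall n ⊆ projZ C)
    (hk : 3 * Real.exp 1 / 2 * ((n : ℝ) + (d : ℝ)) ≤ k) :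
    ∃ y ∈ S, ∀ H : Set (MixedSpace n d), IsClosedHalfspace H → y ∈ H →
      ENNReal.ofReal (1 / Real.exp 1 - 3 * ((n : ℝ) + (d : ℝ)) / (2 * k)) * mixedIntegerVolume S
        ≤ mixedIntegerVolume (S ∩ H) := by
  have hk0 : 0 < k := lt_of_lt_of_le (by positivity) hk
  have hbox' : ∀ u : Fin n → ℝ, (∀ i, |u i| ≤ k) → ∃ x, (z₀ + u, x) ∈ C := by
    intro u hu
    have hmem : k⁻¹ • u ∈ linftyBall n := fun i => by
      simp only [Pi.smul_apply, smul_eq_mul, abs_mul, abs_inv, abs_of_pos hk0]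
      rw [inv_mul_le_iff₀ hk0, mul_one]
      exact hu i
    obtain ⟨y, hy, hyz⟩ := hbox ⟨_, hmem, rfl⟩
    simp only [smul_inv_smul₀ hk0.ne'] at hyz
    exact ⟨y.2, by rwa [← hyz]⟩
  have hVpos : volume C ≠ 0 :=
    (Measure.measure_pos_of_nonempty_interior volume hC.interior_nonempty).ne'
  have hVtop : volume C ≠ ∞ := hC.isCompact.measure_ne_top
  have hid : IntegrableOn (fun y : MixedSpace n d => y) C :=
    continuousOn_id.integrableOn_compact hC.isCompact
  set c : MixedSpace n d := ⨍ y in C, y with hcdef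
  have hcC : c ∈ C := hC.convex.set_average_mem hC.isCompact.isClosed hVpos hVtop
    (ae_restrict_mem hC.isCompact.measurableSet) hid
  have hc : ∀ φ : MixedSpace n d →L[ℝ] ℝ, ∫ y in C, φ y = volume.real C * φ c := by
    intro φ
    have hV : volume.real C ≠ 0 := (ENNReal.toReal_pos hVpos hVtop).ne'
    rw [φ.integral_comp_comm hid, hcdef, setAverage_eq, map_smul, smul_eq_mul,
      mul_inv_cancel_left₀ hV]
  obtain ⟨y, hylat, b, hb, b', hb', hy⟩ := exists_mem_mixedLattice_near hk0 hbox' c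
  have cap : ∀ φ : MixedSpace n d →L[ℝ] ℝ, φ ≠ 0 →
      0 < mixedIntegerVolume (C ∩ {x | φ y ≤ φ x}) ∧
      ENNReal.ofReal (1 / Real.exp 1 - 3 * ((n : ℝ) + (d : ℝ)) / (2 * k)) * mixedIntegerVolume C
        ≤ mixedIntegerVolume (C ∩ {x | φ y ≤ φ x}) := fun φ hφ =>
    hy ▸ mixedIntegerVolume_cap_ge (by omega) hC hbox' hk hcC hc hφ hb hb'
  -- A point outside `C` would lie in a halfspace missing `C`, whose cap would have volume `0`.
  have hyC : y ∈ C := by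
    by_contra hyC
    obtain ⟨φ, u, hφC, hφy⟩ :=
      geometric_hahn_banach_closed_point hC.convex hC.isCompact.isClosed hyC
    have hempty : C ∩ {x | φ y ≤ φ x} = ∅ := by
      ext x
      simpa using fun hx => (hφC x hx).trans hφy
    have hφ0 : φ ≠ 0 := by
      rintro rfl
      exact absurd ((hφC c hcC).trans hφy) (by simp)
    have := (cap φ hφ0).1
    simp [hempty, mixedIntegerVolume, fiber] at this
  subst hS
  refine ⟨y, ⟨hyC, hylat⟩, ?_⟩
  rintro H ⟨a, c₀, ha, rfl⟩ hyH
  rw [mixedIntegerVolume_inter_mixedLattice, mixedIntegerVolume_inter_mixedLattice_inter]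
  refine (cap _ (dotFunctional_ne_zero ha)).2.trans ?_
  refine ENNReal.tsum_le_tsum fun z => measure_mono ?_
  rintro x ⟨hxC, hx⟩
  exact ⟨hxC, le_trans (b := dotFunctional a y) hyH hx⟩
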